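/- For every positive integer $m$, all positive integers $n_1,\ldots,n_m$, and every nonnegative integer $r$, the rational number $$S_{2r+1}(n_1,\ldots,n_m)=n_1^{-1}\binom{n_1+n_m}{n_1}^{-1}\sum_{k=1}^{n_1}k^{2r+1}\prod_{i=1}^{m}\binom{n_i+n_{i+1}}{n_i+k},$$ where $n_{m+1}=n_1$, is either an integer or a half-integer (a number of the form $z+\tfrac12$ with $z$ an integer). -/

import Mathlib

/-- The rational number
`S_{2r+1}(n 1, …, n m) = (n 1)⁻¹ * C(n 1 + n m, n 1)⁻¹ *
  ∑_{k=1}^{n 1} k^(2r+1) * ∏_{i=1}^{m} C(n i + n (i+1), n i + k)`.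
Only the values `n 1, …, n (m + 1)` matter; it is used for `1 ≤ m` and `n (m + 1) = n 1`. -/
def oddPowerBinomialSum (m : ℕ) (n : ℕ → ℕ) (r : ℕ) : ℚ :=
  (n 1 : ℚ)⁻¹ * (Nat.choose (n 1 + n m) (n 1) : ℚ)⁻¹ *
    ∑ k ∈ Finset.Icc 1 (n 1), (k : ℚ) ^ (2 * r + 1) *
      ∏ i ∈ Finset.Icc 1 m, (Nat.choose (n i + n (i + 1)) (n i + k) : ℚ)

/-! Cyclicity lets the factorials in the binomial product be regrouped as `∏ 1 / ((n_i + k)! (n_i -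
k)!)`, up to a constant. Vandermonde (`invFactorialPair_mul`) replaces two adjacent factors by a
combination of single ones, so `chainSum_cons` removes one parameter at a time; its coefficients are
integers by `factorial_mul_chainFactorial_dvd`. With one parameter left, the sum telescopes to `1/2`
for `r = 0`, and `sq_mul_invFactorialPair` lowers the exponent. Twice the sum is therefore an
integer. -/

/-- `1 / (n - k)!`, extended by zero to `k > n`. -/
def invFactorialSub (n k : ℕ) : ℚ := if k ≤ n then ((n - k).factorial : ℚ)⁻¹ else 0

/-- `1 / ((n + k)! (n - k)!)`, extended by zero to `k > n`. -/
def invFactorialPair (n k : ℕ) : ℚ := ((n + k).factorial : ℚ)⁻¹ * invFactorialSub n k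

theorem invFactorialSub_of_lt {n k : ℕ} (h : n < k) : invFactorialSub n k = 0 :=
  if_neg (by omega)

theorem invFactorialSub_add (k x : ℕ) : invFactorialSub (k + x) k = (x.factorial : ℚ)⁻¹ := by
  simp [invFactorialSub]

theorem invFactorialPair_of_lt {n k : ℕ} (h : n < k) : invFactorialPair n k = 0 := by
  simp [invFactorialPair, invFactorialSub_of_lt h]

theorem invFactorialPair_add (k x : ℕ) :
    invFactorialPair (k + x) k = ((2 * k + x).factorial : ℚ)⁻¹ * (x.factorial : ℚ)⁻¹ := by
  rw [invFactorialPair, invFactorialSub_add]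
  congr 4
  omega

theorem choose_eq_factorial_mul_invFactorialSub (a b k : ℕ) :
    ((a + b).choose (a + k) : ℚ) =
      (a + b).factorial * (((a + k).factorial : ℚ)⁻¹ * invFactorialSub b k) := by
  rcases lt_or_ge b k with h | h
  · rw [invFactorialSub_of_lt h, Nat.choose_eq_zero_of_lt (by omega)]
    simp
  · obtain ⟨x, rfl⟩ := Nat.exists_eq_add_of_le h
    rw [invFactorialSub_add, ← add_assoc, Nat.cast_add_choose]
    field_simp

/-- The Chu–Vandermonde identity, as a linearization formula for products. -/
theorem invFactorialPair_mul (a b k : ℕ) :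
    invFactorialPair a k * invFactorialPair b k =
      ((a + b).factorial : ℚ)⁻¹ * ∑ s ∈ Finset.range (b + 1),
        invFactorialSub a s * invFactorialSub b s * invFactorialPair s k := by
  rcases lt_or_ge b k with hb | hb
  · rw [invFactorialPair_of_lt hb, Finset.sum_eq_zero, mul_zero, mul_zero]
    intro s hs
    rw [invFactorialPair_of_lt (by simp at hs; omega), mul_zero]
  rcases lt_or_ge a k with ha | ha
  · rw [invFactorialPair_of_lt ha, Finset.sum_eq_zero, zero_mul, mul_zero]
    intro s hs
    rcases lt_or_ge a s with h | h
    · rw [invFactorialSub_of_lt h, zero_mul, zero_mul]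
    · rw [invFactorialPair_of_lt (by omega), mul_zero]
  obtain ⟨x, rfl⟩ := Nat.exists_eq_add_of_le ha
  obtain ⟨y, rfl⟩ := Nat.exists_eq_add_of_le hb
  rw [add_assoc k y 1, Finset.sum_range_add, Finset.sum_eq_zero (s := Finset.range k), zero_add]
  swap
  · intro s hs
    rw [invFactorialPair_of_lt (by simpa using hs), mul_zero]
  -- With `a = k + x`, `b = k + y`, `s = k + t`, the claim is this Vandermonde convolution.
  have key : ((x + (2 * k + y)).choose y : ℚ) = ∑ t ∈ Finset.range (y + 1),
      (x.choose t : ℚ) * ((2 * k + y).choose (y - t) : ℚ) := by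
    rw [Nat.add_choose_eq, Finset.Nat.sum_antidiagonal_eq_sum_range_succ_mk]
    push_cast
    rfl
  have hterm : ∀ t ∈ Finset.range (y + 1),
      invFactorialSub (k + x) (k + t) * invFactorialSub (k + y) (k + t) *
        invFactorialPair (k + t) k =
      (x.factorial : ℚ)⁻¹ * ((2 * k + y).factorial : ℚ)⁻¹ *
        ((x.choose t : ℚ) * ((2 * k + y).choose (y - t) : ℚ)) := by
    intro t ht
    obtain ⟨u, rfl⟩ := Nat.exists_eq_add_of_le (show t ≤ y by simp at ht; omega)
    rcases lt_or_ge x t with h | h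
    · rw [Nat.choose_eq_zero_of_lt h, invFactorialSub_of_lt (by omega)]
      simp
    obtain ⟨w, rfl⟩ := Nat.exists_eq_add_of_le h
    rw [← add_assoc k t w, ← add_assoc k t u, invFactorialSub_add, invFactorialSub_add,
      invFactorialPair_add, Nat.add_sub_cancel_left, Nat.cast_add_choose,
      show 2 * k + (t + u) = (2 * k + t) + u by ring, ← Nat.choose_symm_add,
      Nat.cast_add_choose]
    field_simp
  rw [Finset.sum_congr rfl hterm, ← Finset.mul_sum, ← key,
    show x + (2 * k + y) = y + (x + 2 * k) by ring, Nat.cast_add_choose,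
    invFactorialPair_add, invFactorialPair_add, show k + x + (k + y) = y + (x + 2 * k) by ring,
    add_comm (2 * k) x]
  field_simp

/-- The factor `(a + 1)² - k² = (a + 1 + k)(a + 1 - k)` cancels into the two factorials. -/
theorem sq_mul_invFactorialPair (a k : ℕ) :
    (k : ℚ) ^ 2 * invFactorialPair (a + 1) k =
      ((a + 1 : ℕ) : ℚ) ^ 2 * invFactorialPair (a + 1) k - invFactorialPair a k := by
  rcases lt_trichotomy k (a + 1) with h | h | h
  · obtain ⟨x, rfl⟩ := Nat.exists_eq_add_of_le (Nat.le_of_lt_succ h)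
    rw [add_assoc k x 1, invFactorialPair_add, invFactorialPair_add, ← add_assoc (2 * k) x 1,
      Nat.factorial_succ, Nat.factorial_succ]
    push_cast
    field_simp
    ring
  · subst h
    rw [invFactorialPair_of_lt (Nat.lt_succ_self a), sub_zero]
  · rw [invFactorialPair_of_lt h, invFactorialPair_of_lt (by omega)]
    simp

/-- Since `2k = (a + 1 + k) - (a + 1 - k)`, the sum telescopes. -/
theorem sum_mul_invFactorialPair (a N : ℕ) (h : a + 1 < N) :
    ∑ k ∈ Finset.range N, (k : ℚ) * invFactorialPair (a + 1) k =
      (2 * (a + 1).factorial * a.factorial : ℚ)⁻¹ := by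
  obtain ⟨N, rfl⟩ := Nat.exists_eq_add_of_le' (show 1 ≤ N by omega)
  have step : ∀ k, ((k + 1 : ℕ) : ℚ) * invFactorialPair (a + 1) (k + 1) =
      ((a + 1 + k).factorial : ℚ)⁻¹ * invFactorialSub (a + 1) (k + 1) / 2 -
      ((a + 1 + (k + 1)).factorial : ℚ)⁻¹ * invFactorialSub (a + 1) (k + 1 + 1) / 2 := by
    intro k
    rcases lt_trichotomy a k with h | h | h
    · rw [invFactorialPair_of_lt (by omega), invFactorialSub_of_lt (by omega),
        invFactorialSub_of_lt (by omega)]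
      simp
    · subst h
      rw [invFactorialSub_of_lt (Nat.lt_succ_self _), invFactorialPair, ← add_assoc (a + 1) a 1,
        Nat.factorial_succ (a + 1 + a)]
      simp only [invFactorialSub, le_refl, if_true]
      push_cast
      field_simp
      ring
    · obtain ⟨x, rfl⟩ := Nat.exists_eq_add_of_le (Nat.succ_le_of_lt h)
      rw [invFactorialPair, show k.succ + x + 1 = k + 1 + (x + 1) by simp; ring,
        invFactorialSub_add, show k + 1 + (x + 1) = k + 1 + 1 + x by ring,
        invFactorialSub_add, ← add_assoc _ k 1, Nat.factorial_succ, Nat.factorial_succ x]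
      push_cast
      field_simp
      ring
  rw [Finset.sum_range_succ', Finset.sum_congr rfl (fun k _ => step k),
    Finset.sum_range_sub' (fun k => ((a + 1 + k).factorial : ℚ)⁻¹ *
      invFactorialSub (a + 1) (k + 1) / 2), invFactorialSub_of_lt (show a + 1 < N + 1 from h)]
  simp [invFactorialSub]
  ring

/-! ### Normalised sums over open chains of parameters -/

/-- `(a + b₁)! (b₁ + b₂)! ⋯ (bₜ₋₁ + bₜ)! bₜ!` for the list `b₁, …, bₜ`. -/
def chainFactorial : ℕ → List ℕ → ℕ
  | a, [] => a.factorial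
  | a, b :: l => (a + b).factorial * chainFactorial b l

theorem chainFactorial_ne_zero (a : ℕ) (l : List ℕ) : chainFactorial a l ≠ 0 := by
  induction l generalizing a with
  | nil => exact Nat.factorial_ne_zero a
  | cons b l ih => exact mul_ne_zero (Nat.factorial_ne_zero _) (ih b)

theorem factorial_mul_chainFactorial_dvd (s x : ℕ) (l : List ℕ) :
    x.factorial * chainFactorial s l ∣ chainFactorial (s + x) l := by
  cases l with
  | nil => exact mul_comm x.factorial _ ▸ Nat.factorial_mul_factorial_dvd_factorial_add s x
  | cons c l =>
    rw [chainFactorial, chainFactorial, ← mul_assoc]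
    refine mul_dvd_mul_right ?_ _
    rw [show s + x + c = x + (s + c) by ring]
    exact Nat.factorial_mul_factorial_dvd_factorial_add x (s + c)

/-- The normalised odd power sum attached to `a + 1` and a list of further parameters. -/
def chainSum (N r a : ℕ) (l : List ℕ) : ℚ :=
  a.factorial * chainFactorial (a + 1) l * ∑ k ∈ Finset.range N,
    (k : ℚ) ^ (2 * r + 1) * (invFactorialPair (a + 1) k * (l.map (invFactorialPair · k)).prod)

/-- Only `k = 0` could contribute, and an odd power kills it. Hence parameter `0` drops out of both
recursions. -/
theorem sum_odd_pow_mul_invFactorialPair_zero (N r : ℕ) (g : ℕ → ℚ) :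
    ∑ k ∈ Finset.range N, (k : ℚ) ^ (2 * r + 1) * (invFactorialPair 0 k * g k) = 0 := by
  refine Finset.sum_eq_zero fun k _ => ?_
  rcases Nat.eq_zero_or_pos k with rfl | h
  · simp
  · rw [invFactorialPair_of_lt h, zero_mul, mul_zero]

theorem chainSum_nil_zero (N a : ℕ) (h : a + 1 < N) : chainSum N 0 a [] = 1 / 2 := by
  have := sum_mul_invFactorialPair a N h
  simp only [chainSum, chainFactorial, List.map_nil, List.prod_nil, mul_one, mul_zero, zero_add,
    pow_one, this]
  field_simp

theorem chainSum_nil_succ (N r a : ℕ) :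
    chainSum N (r + 1) a [] = ((a + 1 : ℕ) : ℚ) ^ 2 * chainSum N r a [] -
      a.factorial * (a + 1).factorial *
        ∑ k ∈ Finset.range N, (k : ℚ) ^ (2 * r + 1) * (invFactorialPair a k * 1) := by
  simp only [chainSum, chainFactorial, List.map_nil, List.prod_nil, mul_one, Finset.mul_sum,
    ← Finset.sum_sub_distrib]
  refine Finset.sum_congr rfl fun k _ => ?_
  linear_combination (a.factorial * (a + 1).factorial * (k : ℚ) ^ (2 * r + 1)) *
    sq_mul_invFactorialPair a k

theorem exists_int_two_mul_chainSum_nil (N r a : ℕ) (h : a + 1 < N) :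
    ∃ z : ℤ, 2 * chainSum N r a [] = z := by
  induction r generalizing a with
  | zero => exact ⟨1, by rw [chainSum_nil_zero N a h]; norm_num⟩
  | succ r ih =>
    obtain ⟨z, hz⟩ := ih a h
    rw [chainSum_nil_succ]
    cases a with
    | zero =>
      rw [sum_odd_pow_mul_invFactorialPair_zero N r fun _ => 1]
      exact ⟨z, by push_cast; linear_combination hz⟩
    | succ a =>
      obtain ⟨w, hw⟩ := ih a (by omega)
      -- The factor `(a + 1)(a + 2)` is the ratio of the normalisations `(a + 1)! (a + 2)!` and `a!
      -- (a + 1)!`.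
      refine ⟨(a + 2) ^ 2 * z - (a + 1) * (a + 2) * w, ?_⟩
      have hw' : 2 * (a.factorial * (a + 1).factorial *
          ∑ k ∈ Finset.range N, (k : ℚ) ^ (2 * r + 1) * (invFactorialPair (a + 1) k * 1)) = w := hw
      rw [Nat.factorial_succ (a + 1), Nat.factorial_succ a] at *
      push_cast at *
      linear_combination ((a : ℚ) + 2) ^ 2 * hz - ((a : ℚ) + 1) * (a + 2) * hw'

/-- Linearization fuses `a + 1` and `b` into a new head; its value `0` contributes nothing, so the
head is written `s + 1`. -/
theorem chainSum_cons (N r a b : ℕ) (l : List ℕ) :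
    chainSum N r a (b :: l) = ∑ s ∈ Finset.range b,
      (a.choose s : ℚ) * (invFactorialSub b (s + 1) * chainFactorial b l /
        chainFactorial (s + 1) l) * chainSum N r s l := by
  have expand : ∀ k, invFactorialPair (a + 1) k * ((b :: l).map (invFactorialPair · k)).prod =
      ((a + 1 + b).factorial : ℚ)⁻¹ * ∑ s ∈ Finset.range (b + 1),
        invFactorialSub (a + 1) s * invFactorialSub b s *
          (invFactorialPair s k * (l.map (invFactorialPair · k)).prod) := by
    intro k
    rw [List.map_cons, List.prod_cons, ← mul_assoc, invFactorialPair_mul, mul_assoc,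
      Finset.sum_mul]
    simp only [mul_assoc]
  have swap : ∑ k ∈ Finset.range N, (k : ℚ) ^ (2 * r + 1) *
      (invFactorialPair (a + 1) k * ((b :: l).map (invFactorialPair · k)).prod) =
      ((a + 1 + b).factorial : ℚ)⁻¹ * ∑ s ∈ Finset.range (b + 1),
        invFactorialSub (a + 1) s * invFactorialSub b s *
          ∑ k ∈ Finset.range N, (k : ℚ) ^ (2 * r + 1) *
            (invFactorialPair s k * (l.map (invFactorialPair · k)).prod) := by
    simp only [expand, Finset.mul_sum]
    rw [Finset.sum_comm]
    refine Finset.sum_congr rfl fun s _ => Finset.sum_congr rfl fun k _ => by ring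
  rw [chainSum, swap, Finset.sum_range_succ', sum_odd_pow_mul_invFactorialPair_zero, mul_zero,
    add_zero, chainFactorial, Finset.mul_sum, Finset.mul_sum]
  refine Finset.sum_congr rfl fun s _ => ?_
  have hP : (chainFactorial (s + 1) l : ℚ) ≠ 0 := by
    exact_mod_cast chainFactorial_ne_zero _ _
  have hC : (a.choose s : ℚ) * s.factorial = a.factorial * invFactorialSub (a + 1) (s + 1) := by
    rcases lt_or_ge a s with h | h
    · rw [Nat.choose_eq_zero_of_lt h, invFactorialSub_of_lt (by omega)]
      simp
    · obtain ⟨x, rfl⟩ := Nat.exists_eq_add_of_le h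
      rw [show s + x + 1 = s + 1 + x by ring, invFactorialSub_add, Nat.cast_add_choose]
      field_simp
  have hF : ((a + 1 + b).factorial : ℚ) ≠ 0 := by exact_mod_cast Nat.factorial_ne_zero _
  rw [chainSum]
  generalize ∑ k ∈ Finset.range N, (k : ℚ) ^ (2 * r + 1) *
    (invFactorialPair (s + 1) k * (l.map (invFactorialPair · k)).prod) = T
  push_cast
  field_simp
  linear_combination (-(invFactorialSub b (s + 1) * chainFactorial b l * T)) * hC

theorem exists_int_two_mul_chainSum (N r a : ℕ) (l : List ℕ) (ha : a + 1 < N)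
    (hl : ∀ b ∈ l, b < N) : ∃ z : ℤ, 2 * chainSum N r a l = z := by
  induction l generalizing a with
  | nil => exact exists_int_two_mul_chainSum_nil N r a ha
  | cons b l ih =>
    have hterm : ∀ s ∈ Finset.range b, ∃ z : ℤ,
        2 * ((a.choose s : ℚ) * (invFactorialSub b (s + 1) * chainFactorial b l /
          chainFactorial (s + 1) l) * chainSum N r s l) = z := by
      intro s hs
      have hsb : s < b := Finset.mem_range.1 hs
      obtain ⟨z, hz⟩ := ih s (by have := hl b (by simp); omega)
        fun c hc => hl c (List.mem_cons_of_mem _ hc)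
      obtain ⟨x, rfl⟩ := Nat.exists_eq_add_of_le (Nat.succ_le_of_lt hsb)
      obtain ⟨q, hq⟩ := factorial_mul_chainFactorial_dvd (s + 1) x l
      refine ⟨a.choose s * q * z, ?_⟩
      have hP : (chainFactorial (s + 1) l : ℚ) ≠ 0 := by
        exact_mod_cast chainFactorial_ne_zero _ _
      rw [Nat.succ_eq_add_one, hq, invFactorialSub_add]
      push_cast
      rw [← hz]
      field_simp
    choose! z hz using hterm
    exact ⟨∑ s ∈ Finset.range b, z s, by
      rw [chainSum_cons, Finset.mul_sum, Finset.sum_congr rfl hz, Int.cast_sum]⟩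

/-! ### From the cyclic sum to an open chain -/

theorem chainFactorial_map_range (t : ℕ) (f : ℕ → ℕ) :
    chainFactorial (f 0) ((List.range t).map fun i => f (i + 1)) =
      (∏ i ∈ Finset.range t, (f i + f (i + 1)).factorial) * (f t).factorial := by
  induction t generalizing f with
  | zero => simp [chainFactorial]
  | succ t ih =>
    rw [List.range_succ_eq_map, List.map_cons, List.map_map, chainFactorial,
      Finset.prod_range_succ']
    have := ih fun i => f (i + 1)
    simp only [Function.comp_def, Nat.succ_eq_add_one] at *
    rw [this]
    ring

theorem prod_choose_cyclic (t : ℕ) (f : ℕ → ℕ) (hcyc : f (t + 1) = f 0) (k : ℕ) :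
    ∏ i ∈ Finset.range (t + 1), ((f i + f (i + 1)).choose (f i + k) : ℚ) =
      (∏ i ∈ Finset.range (t + 1), ((f i + f (i + 1)).factorial : ℚ)) *
        ∏ i ∈ Finset.range (t + 1), invFactorialPair (f i) k := by
  -- Around the cycle, each `(n_{i+1} - k)!` can be paired with `(n_{i+1} + k)!` from the next
  -- binomial.
  have shift : ∏ i ∈ Finset.range (t + 1), invFactorialSub (f (i + 1)) k =
      ∏ i ∈ Finset.range (t + 1), invFactorialSub (f i) k := by
    rw [Finset.prod_range_succ, Finset.prod_range_succ', hcyc]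
  simp only [choose_eq_factorial_mul_invFactorialSub, invFactorialPair, Finset.prod_mul_distrib,
    shift]

theorem prod_map_range (t : ℕ) (g : ℕ → ℚ) :
    g 0 * ((List.range t).map fun i => g (i + 1)).prod = ∏ i ∈ Finset.range (t + 1), g i := by
  rw [Finset.prod_range_succ', mul_comm]
  rfl

theorem oddPowerBinomialSum_eq_chainSum (t : ℕ) (n : ℕ → ℕ) (r N a : ℕ) (ha : n 1 = a + 1)
    (hN : n 1 < N) (hcyc : n (t + 2) = n 1) :
    oddPowerBinomialSum (t + 1) n r =
      chainSum N r a ((List.range t).map fun i => n (i + 2)) := by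
  have hprod : ∀ k, ∏ i ∈ Finset.Icc 1 (t + 1), ((n i + n (i + 1)).choose (n i + k) : ℚ) =
      (∏ i ∈ Finset.range (t + 1), ((n (i + 1) + n (i + 2)).factorial : ℚ)) *
        ∏ i ∈ Finset.range (t + 1), invFactorialPair (n (i + 1)) k := by
    intro k
    rw [← prod_choose_cyclic t (fun i => n (i + 1)) hcyc k, Finset.range_eq_Ico,
      Finset.prod_Ico_add' (fun i => ((n i + n (i + 1)).choose (n i + k) : ℚ))]
    rfl
  have hlist : ∀ k, invFactorialPair (n 1) k *
      (((List.range t).map fun i => n (i + 2)).map (invFactorialPair · k)).prod =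
        ∏ i ∈ Finset.range (t + 1), invFactorialPair (n (i + 1)) k := by
    intro k
    rw [List.map_map]
    exact prod_map_range t fun i => invFactorialPair (n (i + 1)) k
  have hsum : ∑ k ∈ Finset.Icc 1 (n 1), (k : ℚ) ^ (2 * r + 1) *
        ∏ i ∈ Finset.range (t + 1), invFactorialPair (n (i + 1)) k =
      ∑ k ∈ Finset.range N, (k : ℚ) ^ (2 * r + 1) *
        ∏ i ∈ Finset.range (t + 1), invFactorialPair (n (i + 1)) k := by
    refine Finset.sum_subset (fun k hk => ?_) fun k _ hk => ?_
    · simp at hk ⊢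
      omega
    · rcases Nat.eq_zero_or_pos k with rfl | h
      · simp
      · rw [← hlist, invFactorialPair_of_lt, zero_mul, mul_zero]
        simp at hk
        omega
  have hchain := chainFactorial_map_range t fun i => n (i + 1)
  simp only [zero_add, add_assoc, Nat.reduceAdd] at hchain
  rw [chainSum, ← ha, hchain]
  simp only [hlist]
  rw [← hsum, oddPowerBinomialSum]
  simp only [hprod]
  -- The prefactor's binomial cancels the closing factor `(n_m + n_1)!`, which opens the cycle.
  rw [Nat.cast_add_choose, Finset.prod_range_succ (fun i => ((n (i + 1) + n (i + 2)).factorial : ℚ)),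
    hcyc, add_comm (n (t + 1)) (n 1), Finset.mul_sum, Finset.mul_sum]
  have hfac : ((n 1).factorial : ℚ) = n 1 * a.factorial := by
    rw [ha, Nat.factorial_succ]
    push_cast
    ring
  have hn : (n 1 : ℚ) ≠ 0 := by rw [ha]; positivity
  refine Finset.sum_congr rfl fun k _ => ?_
  push_cast
  rw [hfac]
  field_simp

/-- For positive integers `n 1, …, n m` with the cyclic convention `n (m + 1) = n 1`, and any
natural number `r`, the normalised sum `S_{2r+1}(n 1, …, n m)` is an integer or a half-integer
(that is, of the form `z + 1/2` with `z` an integer). -/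
theorem theorem1p3 (m : ℕ) (hm : 1 ≤ m) (n : ℕ → ℕ)
    (hpos : ∀ i ∈ Finset.Icc 1 m, 0 < n i) (hcyc : n (m + 1) = n 1) (r : ℕ) :
    (∃ z : ℤ, oddPowerBinomialSum m n r = (z : ℚ)) ∨
      (∃ z : ℤ, oddPowerBinomialSum m n r = (z : ℚ) + 1 / 2) := by
  obtain ⟨t, rfl⟩ := Nat.exists_eq_add_of_le' hm
  obtain ⟨a, ha⟩ := Nat.exists_eq_add_of_le' (hpos 1 (by simp))
  -- One cutoff above every parameter serves all the sums, as terms beyond a parameter vanish.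
  have hle : ∀ i ∈ Finset.range (t + 2), n i < (∑ i ∈ Finset.range (t + 2), n i) + 1 :=
    fun i hi => Nat.lt_succ_of_le (Finset.single_le_sum (fun _ _ => Nat.zero_le _) hi)
  have h1 := hle 1 (by simp)
  obtain ⟨z, hz⟩ := exists_int_two_mul_chainSum _ r a ((List.range t).map fun i => n (i + 2))
    (ha ▸ h1) fun b hb => by
      obtain ⟨i, hi, rfl⟩ := List.mem_map.1 hb
      exact hle _ (by simp at hi ⊢; omega)
  rw [← oddPowerBinomialSum_eq_chainSum t n r _ a ha h1 hcyc] at hz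
  rcases Int.even_or_odd' z with ⟨w, rfl | rfl⟩
  · exact Or.inl ⟨w, by push_cast at hz; linarith⟩
  · exact Or.inr ⟨w, by push_cast at hz; linarith⟩
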